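/- Let $l>0$ and $\Lambda=-1/l^2$. Use coordinates $x=(r,\tau,\phi)$ on $\mathbb R^3$, with capital indices $A,B$ running over $x^A=(\tau,\phi)$ (functions periodic in $\phi$ are the case of a cylinder at infinity; periodicity is not needed). Let $U\subseteq\mathbb R^3$ be open and let $T\subseteq\mathbb R^2$ be a set of boundary points with $(r_0,\infty)\times T\subseteq U$ for some $r_0$. All symbols $O$, $o$ refer to $r\to\infty$, uniformly for $(\tau,\phi)\in T$ ($T$ is arbitrary: a point, a compact set, or all of $\mathbb R^2$). Write $f=O_2(r^n)$ if $f=O(r^n)$, $\partial_i f=O(r^{n-w_i})$ and $\partial_i\partial_j f=O(r^{n-w_i-w_j})$ for all $i,j$, where $w_r=1$ and $w_\tau=w_\phi=0$. Let $g$ be a pseudo-Riemannian metric of class $C^2$ on $U$ which solves Einstein's equations $R_{\mu\nu}-\frac12 R\,g_{\mu\nu}+\Lambda g_{\mu\nu}=0$ on $U$ and satisfies the Brown–Henneaux boundary conditions with flat boundary metric $\bar\gamma_{AB}dx^Adx^B=-d\tau^2+d\phi^2$: $$g_{AB}=r^2\bar\gamma_{AB}+O_2(1),\qquad g_{rA}=O_2(r^{-3}),\qquad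 g_{rr}=\frac{l^2}{r^2}+O_2(r^{-4}).$$ Let $K=h^{AB}K_{AB}$ be the trace of the extrinsic curvature of the surfaces $r=\mathrm{const}$, where $h_{AB}=g_{AB}$ is the induced metric, $K_{AB}=-\nabla_A n_B$ and $n_\mu=(g^{rr})^{-1/2}\partial_\mu r$, and let ${}_0K=-2/l$. Then $$K-{}_0K=o(r^{-2}).$$ Moreover, whenever the leading coefficients in the fall-offs exist, i.e. whenever $C_{rr}$ and $C_{AB}$ are functions of $(\tau,\phi)$ with $g_{rr}=\frac{l^2}{r^2}+C_{rr}r^{-4}+o(r^{-4})$ and $g_{AB}=r^2\bar\gamma_{AB}+C_{AB}+o(1)$, the metric $g$ satisfies the generalized boundary conditions $$g_{rr}=\frac{l^2}{r^2}+C_{rr}r^{-4}+o(r^{-4}),\quad g_{rA}=O(r^{-3}),\quad g_{AB}=r^2\gamma_{AB}+C_{AB}+o(1),\quad K-{}_0K=o(r^{-2}),$$ where $\gamma_{AB}=e^{2\varphi}\bar\gamma_{AB}$ with $\varphi=0$, and $$\rho\equiv\gamma^{AB}C_{AB}+\frac{1}{l^2}C_{rr}=0\quad\text{on }T.$$ 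-/

import Mathlib

open Filter Asymptotics
open scoped Topology

namespace AdS3

noncomputable section

/-! Coordinates on the three-dimensional space-time are `x = (r, τ, φ)`: coordinate `0` is the
radial one, and the boundary index `A : Fin 2` (`0` for `τ`, `1` for `φ`) is the space-time index
`A.succ`. -/

/-- A point of three-dimensional coordinate space. -/
abbrev Coord : Type := Fin 3 → ℝ

/-- A point of the boundary (of its universal cover), with coordinates `(τ, φ)`. -/
abbrev BCoord : Type := Fin 2 → ℝ

/-- A field of `3 × 3` matrices: the components `g_{μν}(x)` of a space-time metric. -/
abbrev Metric3 : Type := Coord → Matrix (Fin 3) (Fin 3) ℝ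

/-- A field of `2 × 2` matrices on the boundary. -/
abbrev BTensor : Type := BCoord → Matrix (Fin 2) (Fin 2) ℝ

/-- The point with radial coordinate `r` and boundary coordinates `y = (τ, φ)`. -/
def point (r : ℝ) (y : BCoord) : Coord := Fin.cons r y

/-- The boundary coordinates `(τ, φ)` of a point. -/
def bdry (x : Coord) : BCoord := fun A => x A.succ

/-! ### Differential geometry in coordinates -/

/-- The partial derivative `∂_i f` at `x`. -/
def pd (i : Fin 3) (f : Coord → ℝ) (x : Coord) : ℝ := fderiv ℝ f x (Pi.single i 1)

/-- `g` is a pseudo-Riemannian metric of class `C²` on the coordinate domain `U`. -/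
structure IsMetricOn (g : Metric3) (U : Set Coord) : Prop where
  contDiffOn : ∀ i j, ContDiffOn ℝ 2 (fun x => g x i j) U
  symm : ∀ x ∈ U, (g x).IsSymm
  nondegenerate : ∀ x ∈ U, (g x).det ≠ 0

/-- The Christoffel symbols `Γ^k_{ij}` of the Levi-Civita connection of `g`. -/
def christoffel (g : Metric3) (k i j : Fin 3) (x : Coord) : ℝ :=
  (1 / 2) * ∑ m, (g x)⁻¹ k m *
    (pd i (fun z => g z m j) x + pd j (fun z => g z m i) x - pd m (fun z => g z i j) x)

/-- The Ricci tensor `R_{ij}` of `g`. -/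
def ricci (g : Metric3) (i j : Fin 3) (x : Coord) : ℝ :=
  ∑ k, (pd k (christoffel g k i j) x - pd j (christoffel g k i k) x)
    + ∑ k, ∑ m, (christoffel g k k m x * christoffel g m i j x
        - christoffel g k j m x * christoffel g m i k x)

/-- The scalar curvature `R = g^{ij} R_{ij}`. -/
def scalarCurvature (g : Metric3) (x : Coord) : ℝ :=
  ∑ i, ∑ j, (g x)⁻¹ i j * ricci g i j x

/-- The vacuum Einstein equations `G_{ij} + Λ g_{ij} = 0` on `U`. -/
def SolvesEinstein (Λ : ℝ) (g : Metric3) (U : Set Coord) : Prop :=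
  ∀ x ∈ U, ∀ i j, ricci g i j x - (1 / 2) * scalarCurvature g x * g x i j + Λ * g x i j = 0

/-- The covariant derivative `∇_i ω_j = ∂_i ω_j - Γ^k_{ij} ω_k` of a covector field. -/
def covDeriv (g : Metric3) (ω : Coord → Fin 3 → ℝ) (i j : Fin 3) (x : Coord) : ℝ :=
  pd i (fun z => ω z j) x - ∑ k, christoffel g k i j x * ω x k

/-! ### Extrinsic geometry of the surfaces `r = const` -/

/-- The outward unit conormal `n_i = (g^{rr})^{-1/2} ∂_i r` of the surfaces `r = const`. -/
def unitNormal (g : Metric3) (x : Coord) (i : Fin 3) : ℝ :=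
  if i = 0 then (Real.sqrt ((g x)⁻¹ 0 0))⁻¹ else 0

/-- The induced metric `h_{AB} = g_{AB}` on the surface `r = const`. -/
def inducedMetric (g : Metric3) (x : Coord) : Matrix (Fin 2) (Fin 2) ℝ :=
  Matrix.of fun A B => g x A.succ B.succ

/-- The extrinsic curvature `K_{AB} = - ∇_A n_B` of the surface `r = const`. -/
def extrinsicCurvature (g : Metric3) (A B : Fin 2) (x : Coord) : ℝ :=
  - covDeriv g (unitNormal g) A.succ B.succ x

/-- The trace `K = h^{AB} K_{AB}` of the extrinsic curvature. -/
def meanCurvature (g : Metric3) (x : Coord) : ℝ :=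
  ∑ A, ∑ B, (inducedMetric g x)⁻¹ A B * extrinsicCurvature g A B x

/-- The counter-term `₀K = -2 / l`. -/
def K₀ (l : ℝ) : ℝ := -2 / l

/-! ### Fall-off conditions -/

/-- `f = O(r^n)` as `r → ∞`, uniformly for boundary coordinates in `T`. -/
def FallsBigO (T : Set BCoord) (f : Coord → ℝ) (n : ℤ) : Prop :=
  (fun p : ℝ × BCoord => f (point p.1 p.2)) =O[atTop ×ˢ 𝓟 T] fun p => p.1 ^ n

/-- `f = o(r^n)` as `r → ∞`, uniformly for boundary coordinates in `T`. -/
def FallsLittleO (T : Set BCoord) (f : Coord → ℝ) (n : ℤ) : Prop :=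
  (fun p : ℝ × BCoord => f (point p.1 p.2)) =o[atTop ×ˢ 𝓟 T] fun p => p.1 ^ n

/-- The number of powers of `r` gained by a derivative: one for `∂_r`, none for `∂_τ`, `∂_φ`. -/
def weight (i : Fin 3) : ℤ := if i = 0 then 1 else 0

/-- `f = O(r^n)` together with its derivatives up to second order, each radial derivative
improving the estimate by one power of `r`. -/
structure FallsBigO₂ (T : Set BCoord) (f : Coord → ℝ) (n : ℤ) : Prop where
  zero : FallsBigO T f n
  one : ∀ i, FallsBigO T (pd i f) (n - weight i)
  two : ∀ i j, FallsBigO T (pd i (pd j f)) (n - weight i - weight j)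

/-- The flat boundary metric `-dτ² + dφ²`. -/
def flatMetric : BTensor := fun _ => !![-1, 0; 0, 1]

/-- The Brown-Henneaux boundary conditions with fixed boundary metric `γbar`. -/
structure BrownHenneaux (l : ℝ) (γbar : BTensor) (T : Set BCoord) (g : Metric3) : Prop where
  tangential : ∀ A B : Fin 2,
    FallsBigO₂ T (fun x => g x A.succ B.succ - x 0 ^ 2 * γbar (bdry x) A B) 0
  mixed : ∀ A : Fin 2, FallsBigO₂ T (fun x => g x 0 A.succ) (-3)
  radial : FallsBigO₂ T (fun x => g x 0 0 - l ^ 2 / x 0 ^ 2) (-4)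

/-- The boundary metric `γ = e^{2 φ} γbar` in the conformal class of `γbar`. -/
def conformalMetric (γbar : BTensor) (φ : BCoord → ℝ) : BTensor :=
  fun y => Real.exp (2 * φ y) • γbar y

/-- `g_{rr} = l²/r² + C_{rr} r⁻⁴ + o(r⁻⁴)` and `g_{AB} = r² γ_{AB} + C_{AB} + o(1)`. -/
structure HasLeadingTerms (l : ℝ) (γ : BTensor) (T : Set BCoord) (g : Metric3)
    (Crr : BCoord → ℝ) (CAB : BTensor) : Prop where
  radial : FallsLittleO T
    (fun x => g x 0 0 - (l ^ 2 / x 0 ^ 2 + Crr (bdry x) * x 0 ^ (-4 : ℤ))) (-4)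
  tangential : ∀ A B : Fin 2, FallsLittleO T
    (fun x => g x A.succ B.succ - (x 0 ^ 2 * γ (bdry x) A B + CAB (bdry x) A B)) 0

/-- The generalized boundary conditions: only the conformal class of the boundary metric `γbar` is
fixed (`φ` being the conformal factor), and `K - ₀K = o(r⁻²)`. -/
structure GeneralizedBC (l : ℝ) (γbar : BTensor) (φ : BCoord → ℝ) (T : Set BCoord)
    (g : Metric3) (Crr : BCoord → ℝ) (CAB : BTensor) : Prop
    extends HasLeadingTerms l (conformalMetric γbar φ) T g Crr CAB where
  mixed : ∀ A : Fin 2, FallsBigO T (fun x => g x 0 A.succ) (-3)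
  curvature : FallsLittleO T (fun x => meanCurvature g x - K₀ l) (-2)

/-- `ρ = γ^{AB} C_{AB} + C_{rr} / l²`. -/
def rho (l : ℝ) (γ : BTensor) (Crr : BCoord → ℝ) (CAB : BTensor) (y : BCoord) : ℝ :=
  ∑ A, ∑ B, (γ y)⁻¹ A B * CAB y A B + (1 / l ^ 2) * Crr y

end

end AdS3

/-! The radial constraint among Einstein's equations carries everything. In dimension three `G^{rr}`
involves only `R_{τφτφ}` (`einstein_contraction`), so that component equals `Λ det h`, and the Gauss
equation (`gauss_equation`) expresses `det K_{AB}` through `Λ det h` and the intrinsic curvature of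
`r = const`.

Write `K_{AB} = -h_{AB}/l + L_{AB}` with `L = O(1)` (`deviation`). Expanding the determinant, the
term `det h / l²` cancels against `Λ = -1/l²`, and the part linear in `L` is `-(det h / l)(K - ₀K)`.
All remaining terms are `O(1)` because the leading boundary metric is constant in `τ, φ`; since `det
h ~ -r⁴`, this gives `K - ₀K = O(r⁻⁴)` (`fallsBigO_meanCurvature`).

For `ρ`, the same estimate makes the flat trace of `L` small. Expressed through the metric it
becomes a radial equation for `u = g_{φφ} - g_{ττ} - 2r²` (`radial_pd_trace_eq`): `r u' / 2 - u -
C_{rr}/l²` tends to `0`. As `u` tends to `C_{φφ} - C_{ττ}`, `r u'` tends to `2ρ`; a convergent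
function cannot have `r u'` tending to a nonzero limit (`eq_zero_of_tendsto_mul_deriv`), so `ρ = 0`.
-/

namespace AdS3

/-! ### Partial derivatives -/

section PartialDerivatives

variable {f f' : Coord → ℝ} {x : Coord} {i j : Fin 3}

theorem pd_add (hf : DifferentiableAt ℝ f x) (hf' : DifferentiableAt ℝ f' x) :
    pd i (fun z => f z + f' z) x = pd i f x + pd i f' x := by
  simp [pd, fderiv_fun_add hf hf']

theorem pd_sub (hf : DifferentiableAt ℝ f x) (hf' : DifferentiableAt ℝ f' x) :
    pd i (fun z => f z - f' z) x = pd i f x - pd i f' x := by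
  simp [pd, fderiv_fun_sub hf hf']

theorem pd_mul (hf : DifferentiableAt ℝ f x) (hf' : DifferentiableAt ℝ f' x) :
    pd i (fun z => f z * f' z) x = pd i f x * f' x + f x * pd i f' x := by
  simp [pd, fderiv_fun_mul hf hf']
  ring

theorem pd_const (i : Fin 3) (c : ℝ) (x : Coord) : pd i (fun _ => c) x = 0 := by
  simp [pd]

theorem pd_const_mul (c : ℝ) (hf : DifferentiableAt ℝ f x) :
    pd i (fun z => c * f z) x = c * pd i f x := by
  rw [pd_mul (differentiableAt_const c) hf, pd_const]
  ring

theorem pd_sum {ι : Type*} {s : Finset ι} {F : ι → Coord → ℝ}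
    (hF : ∀ m ∈ s, DifferentiableAt ℝ (F m) x) :
    pd i (fun z => ∑ m ∈ s, F m z) x = ∑ m ∈ s, pd i (F m) x := by
  simp [pd, fderiv_fun_sum hF]

theorem pd_congr (h : f =ᶠ[𝓝 x] f') : pd i f x = pd i f' x := by
  simp [pd, h.fderiv_eq]

theorem differentiableAt_pd (hf : ContDiffAt ℝ 2 f x) : DifferentiableAt ℝ (pd i f) x := by
  have h : DifferentiableAt ℝ (fderiv ℝ f) x :=
    (hf.fderiv_right (m := 1) (by norm_num)).differentiableAt (by norm_num)
  exact h.clm_apply (differentiableAt_const _)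

theorem pd_pd (hf : ContDiffAt ℝ 2 f x) :
    pd i (pd j f) x = fderiv ℝ (fderiv ℝ f) x (Pi.single i 1) (Pi.single j 1) := by
  have h : DifferentiableAt ℝ (fderiv ℝ f) x :=
    (hf.fderiv_right (m := 1) (by norm_num)).differentiableAt (by norm_num)
  have e : pd j f = fun z => fderiv ℝ f z (Pi.single j 1) := rfl
  rw [pd, e, fderiv_clm_apply h (differentiableAt_const _)]
  simp

theorem pd_comm (hf : ContDiffAt ℝ 2 f x) (i j : Fin 3) : pd i (pd j f) x = pd j (pd i f) x := by
  rw [pd_pd hf, pd_pd hf]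
  exact (hf.isSymmSndFDerivAt (by simp)).eq _ _

end PartialDerivatives

/-! ### The curvature tensor with lowered indices -/

/-- The Christoffel symbols of the first kind `Γ_{m,ij}`. -/
noncomputable def christoffelLower (g : Metric3) (m i j : Fin 3) (x : Coord) : ℝ :=
  (1 / 2) * (pd i (fun z => g z m j) x + pd j (fun z => g z m i) x - pd m (fun z => g z i j) x)

/-- The Riemann tensor `R_{aikj}` with all indices lowered. -/
noncomputable def riemannLower (g : Metric3) (a i k j : Fin 3) (x : Coord) : ℝ :=
  pd k (christoffelLower g a i j) x - pd j (christoffelLower g a i k) x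
    - ∑ b, ∑ m, (g x)⁻¹ b m * (christoffelLower g b k a x * christoffelLower g m i j x
        - christoffelLower g b j a x * christoffelLower g m i k x)

theorem christoffel_eq_sum (g : Metric3) (k i j : Fin 3) (x : Coord) :
    christoffel g k i j x = ∑ m, (g x)⁻¹ k m * christoffelLower g m i j x := by
  rw [christoffel, Finset.mul_sum]
  refine Finset.sum_congr rfl fun m _ => ?_
  rw [christoffelLower]
  ring

namespace IsMetricOn

variable {g : Metric3} {U : Set Coord} {x : Coord}

theorem contDiffAt (hg : IsMetricOn g U) (hU : IsOpen U) (hx : x ∈ U) (i j : Fin 3) :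
    ContDiffAt ℝ 2 (fun z => g z i j) x :=
  (hg.contDiffOn i j).contDiffAt (hU.mem_nhds hx)

theorem differentiableAt (hg : IsMetricOn g U) (hU : IsOpen U) (hx : x ∈ U) (i j : Fin 3) :
    DifferentiableAt ℝ (fun z => g z i j) x :=
  (hg.contDiffAt hU hx i j).differentiableAt (by norm_num)

theorem apply_comm (hg : IsMetricOn g U) (hx : x ∈ U) (i j : Fin 3) : g x i j = g x j i :=
  (hg.symm x hx).apply j i

theorem inv_comm (hg : IsMetricOn g U) (hx : x ∈ U) (i j : Fin 3) :
    (g x)⁻¹ i j = (g x)⁻¹ j i := by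
  have h : ((g x)⁻¹).IsSymm := by
    rw [Matrix.IsSymm, Matrix.transpose_nonsing_inv, (hg.symm x hx).eq]
  exact h.apply j i

theorem pd_apply_comm (hg : IsMetricOn g U) (hU : IsOpen U) (hx : x ∈ U) (k i j : Fin 3) :
    pd k (fun z => g z i j) x = pd k (fun z => g z j i) x :=
  pd_congr <| by
    filter_upwards [hU.mem_nhds hx] with z hz using hg.apply_comm hz i j

theorem pd_pd_apply_comm (hg : IsMetricOn g U) (hU : IsOpen U) (hx : x ∈ U) (l k i j : Fin 3) :
    pd l (pd k fun z => g z i j) x = pd l (pd k fun z => g z j i) x :=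
  pd_congr <| by
    filter_upwards [hU.mem_nhds hx] with z hz using hg.pd_apply_comm hU hz k i j

theorem differentiableAt_inv (hg : IsMetricOn g U) (hU : IsOpen U) (hx : x ∈ U) (i j : Fin 3) :
    DifferentiableAt ℝ (fun z => (g z)⁻¹ i j) x := by
  have h := hg.differentiableAt hU hx
  have hd : DifferentiableAt ℝ (fun z => (g z).det) x := by
    simp only [Matrix.det_fin_three]
    fun_prop
  have ha : DifferentiableAt ℝ (fun z => (g z).adjugate i j) x := by
    simp only [Matrix.adjugate_fin_three]
    fin_cases i <;> fin_cases j <;> simp <;> fun_prop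
  simp only [Matrix.inv_def, Ring.inverse_eq_inv', Matrix.smul_apply, smul_eq_mul]
  exact (hd.inv (hg.nondegenerate x hx)).mul ha

theorem inv_mul_eq (hg : IsMetricOn g U) (hx : x ∈ U) (i j : Fin 3) :
    ∑ m, (g x)⁻¹ i m * g x m j = (1 : Matrix (Fin 3) (Fin 3) ℝ) i j := by
  rw [← Matrix.mul_apply, Matrix.nonsing_inv_mul _ (hg.nondegenerate x hx).isUnit]

theorem mul_inv_eq (hg : IsMetricOn g U) (hx : x ∈ U) (i j : Fin 3) :
    ∑ m, g x i m * (g x)⁻¹ m j = (1 : Matrix (Fin 3) (Fin 3) ℝ) i j := by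
  rw [← Matrix.mul_apply, Matrix.mul_nonsing_inv _ (hg.nondegenerate x hx).isUnit]

theorem pd_inv (hg : IsMetricOn g U) (hU : IsOpen U) (hx : x ∈ U) (l i j : Fin 3) :
    pd l (fun z => (g z)⁻¹ i j) x
      = -∑ a, ∑ b, (g x)⁻¹ i a * pd l (fun z => g z a b) x * (g x)⁻¹ b j := by
  -- Differentiate `g⁻¹ g = 1`, then multiply by `g⁻¹` on the right.
  have key : ∀ b, ∑ a, (pd l (fun z => (g z)⁻¹ i a) x * g x a b
      + (g x)⁻¹ i a * pd l (fun z => g z a b) x) = 0 := fun b => by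
    have h1 : pd l (fun z => ∑ a, (g z)⁻¹ i a * g z a b) x = 0 := by
      rw [← pd_const l ((1 : Matrix (Fin 3) (Fin 3) ℝ) i b) x]
      refine pd_congr ?_
      filter_upwards [hU.mem_nhds hx] with z hz using hg.inv_mul_eq hz i b
    rw [pd_sum fun a _ => (hg.differentiableAt_inv hU hx i a).fun_mul
      (hg.differentiableAt hU hx a b)] at h1
    rw [← h1]
    exact Finset.sum_congr rfl fun a _ => (pd_mul (hg.differentiableAt_inv hU hx i a)
      (hg.differentiableAt hU hx a b)).symm
  have e : ∑ b, (∑ a, (pd l (fun z => (g z)⁻¹ i a) x * g x a b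
      + (g x)⁻¹ i a * pd l (fun z => g z a b) x)) * (g x)⁻¹ b j = 0 :=
    Finset.sum_eq_zero fun b _ => by rw [key b, zero_mul]
  have e2 : ∑ a, pd l (fun z => (g z)⁻¹ i a) x * ∑ b, g x a b * (g x)⁻¹ b j
      = pd l (fun z => (g z)⁻¹ i j) x := by
    simp [hg.mul_inv_eq hx, Matrix.one_apply]
  rw [← e2, eq_neg_iff_add_eq_zero, ← e]
  simp only [Fin.sum_univ_three]
  ring

/-- Metric compatibility of the Levi-Civita connection. -/
theorem pd_apply_eq (hg : IsMetricOn g U) (hU : IsOpen U) (hx : x ∈ U) (l a b : Fin 3) :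
    pd l (fun z => g z a b) x = christoffelLower g a l b x + christoffelLower g b l a x := by
  simp only [christoffelLower]
  rw [hg.pd_apply_comm hU hx l b a, hg.pd_apply_comm hU hx b l a, hg.pd_apply_comm hU hx a l b]
  ring

theorem christoffelLower_comm (hg : IsMetricOn g U) (hU : IsOpen U) (hx : x ∈ U)
    (m i j : Fin 3) : christoffelLower g m i j x = christoffelLower g m j i x := by
  simp only [christoffelLower]
  rw [hg.pd_apply_comm hU hx m i j]
  ring

theorem differentiableAt_christoffelLower (hg : IsMetricOn g U) (hU : IsOpen U) (hx : x ∈ U)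
    (m i j : Fin 3) : DifferentiableAt ℝ (christoffelLower g m i j) x := by
  have h := fun k i j => differentiableAt_pd (i := k) (hg.contDiffAt hU hx i j)
  exact (((h i m j).add (h j m i)).sub (h m i j)).const_mul _

theorem pd_christoffelLower (hg : IsMetricOn g U) (hU : IsOpen U) (hx : x ∈ U)
    (l m i j : Fin 3) : pd l (christoffelLower g m i j) x
      = (1 / 2) * (pd l (pd i fun z => g z m j) x + pd l (pd j fun z => g z m i) x
        - pd l (pd m fun z => g z i j) x) := by
  have h := fun k i j => differentiableAt_pd (i := k) (hg.contDiffAt hU hx i j)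
  have e : christoffelLower g m i j = fun x => (1 / 2) * (pd i (fun z => g z m j) x
      + pd j (fun z => g z m i) x - pd m (fun z => g z i j) x) := rfl
  rw [e, pd_const_mul _ (((h i m j).fun_add (h j m i)).fun_sub (h m i j)),
    pd_sub ((h i m j).fun_add (h j m i)) (h m i j), pd_add (h i m j) (h j m i)]

/-- By metric compatibility the derivative of `g⁻¹` yields two quadratic terms; one cancels the
product of Christoffel symbols on the left, the other survives. This is half of the passage from the
Ricci tensor to `riemannLower`. -/
theorem pd_christoffel_add (hg : IsMetricOn g U) (hU : IsOpen U) (hx : x ∈ U)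
    (l k i j : Fin 3) :
    pd l (christoffel g k i j) x + ∑ m, christoffel g k l m x * christoffel g m i j x
      = ∑ a, (g x)⁻¹ k a * (pd l (christoffelLower g a i j) x - ∑ b, ∑ m, (g x)⁻¹ b m *
          (christoffelLower g b l a x * christoffelLower g m i j x)) := by
  have e : christoffel g k i j = fun x => ∑ m, (g x)⁻¹ k m * christoffelLower g m i j x :=
    funext fun x => christoffel_eq_sum g k i j x
  rw [e, pd_sum fun m _ => (hg.differentiableAt_inv hU hx k m).fun_mul
    (hg.differentiableAt_christoffelLower hU hx m i j)]
  have e2 : ∀ m, pd l (fun z => (g z)⁻¹ k m * christoffelLower g m i j z) x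
      = (-∑ a, ∑ b, (g x)⁻¹ k a * (christoffelLower g a l b x + christoffelLower g b l a x)
          * (g x)⁻¹ b m) * christoffelLower g m i j x
        + (g x)⁻¹ k m * pd l (christoffelLower g m i j) x := fun m => by
    rw [pd_mul (hg.differentiableAt_inv hU hx k m)
      (hg.differentiableAt_christoffelLower hU hx m i j), hg.pd_inv hU hx]
    simp only [hg.pd_apply_eq hU hx]
  simp only [e2, christoffel_eq_sum, Fin.sum_univ_three]
  ring

theorem ricci_eq (hg : IsMetricOn g U) (hU : IsOpen U) (hx : x ∈ U) (i j : Fin 3) :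
    ricci g i j x = ∑ k, ∑ a, (g x)⁻¹ k a * riemannLower g a i k j x := by
  have e : ricci g i j x = ∑ k,
      ((pd k (christoffel g k i j) x + ∑ m, christoffel g k k m x * christoffel g m i j x)
      - (pd j (christoffel g k i k) x
        + ∑ m, christoffel g k j m x * christoffel g m i k x)) := by
    simp only [ricci, Finset.sum_sub_distrib, Finset.sum_add_distrib]
    ring
  rw [e]
  refine Finset.sum_congr rfl fun k _ => ?_
  rw [hg.pd_christoffel_add hU hx, hg.pd_christoffel_add hU hx, ← Finset.sum_sub_distrib]
  refine Finset.sum_congr rfl fun a _ => ?_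
  simp only [riemannLower, mul_sub, Finset.sum_sub_distrib]
  ring

theorem riemannLower_swap_right (g : Metric3) (a i k j : Fin 3) (x : Coord) :
    riemannLower g a i k j x = -riemannLower g a i j k x := by
  simp only [riemannLower, mul_sub, Finset.sum_sub_distrib]
  ring

/-- Second derivatives of a `C²` metric commute, which settles the linear part; the quadratic part
only needs a relabelling of the summed indices (`hq`). -/
theorem riemannLower_swap_left (hg : IsMetricOn g U) (hU : IsOpen U) (hx : x ∈ U)
    (a i k j : Fin 3) : riemannLower g a i k j x = -riemannLower g i a k j x := by
  have hq : ∀ k j, ∑ b, ∑ m, (g x)⁻¹ b m * (christoffelLower g b k a x *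
      christoffelLower g m i j x) = ∑ b, ∑ m, (g x)⁻¹ b m * (christoffelLower g b j i x *
      christoffelLower g m a k x) := fun k j => by
    rw [Finset.sum_comm]
    refine Finset.sum_congr rfl fun b _ => Finset.sum_congr rfl fun m _ => ?_
    rw [hg.inv_comm hx m b, hg.christoffelLower_comm hU hx m k a,
      hg.christoffelLower_comm hU hx b i j]
    ring
  simp only [riemannLower, mul_sub, Finset.sum_sub_distrib, hg.pd_christoffelLower hU hx, hq k j,
    hq j k]
  rw [pd_comm (hg.contDiffAt hU hx a i) k j, hg.pd_pd_apply_comm hU hx j k a i,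
    pd_comm (hg.contDiffAt hU hx i a) k j]
  rw [hg.pd_pd_apply_comm hU hx j k i a]
  ring

end IsMetricOn

/-! ### The Gauss equation for the surfaces `r = const` -/

/-- With `P = g⁻¹` the left side is the Einstein tensor component `G^{rr}`. The identity is pure
algebra in dimension three: antisymmetry in each index pair makes every component of `R` other than
the fully tangential one drop out. -/
theorem einstein_contraction {P : Matrix (Fin 3) (Fin 3) ℝ} (hP : ∀ i j, P i j = P j i)
    {R : Fin 3 → Fin 3 → Fin 3 → Fin 3 → ℝ} (hl : ∀ a i k j, R a i k j = -R i a k j)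
    (hr : ∀ a i k j, R a i k j = -R a i j k) :
    ∑ i, ∑ j, P 0 i * P 0 j * (∑ k, ∑ a, P k a * R a i k j)
        - (1 / 2) * P 0 0 * ∑ i, ∑ j, P i j * (∑ k, ∑ a, P k a * R a i k j)
      = -(R 1 2 1 2 * P.det) := by
  have z1 : ∀ a k j, R a a k j = 0 := fun a k j => by linarith [hl a a k j]
  have z2 : ∀ a i k, R a i k k = 0 := fun a i k => by linarith [hr a i k k]
  simp only [Fin.sum_univ_three, Matrix.det_fin_three, z1, z2, hP 1 0, hP 2 0, hP 2 1,
    hl 1 0, hl 2 0, hl 2 1, hr _ _ 1 0, hr _ _ 2 0, hr _ _ 2 1]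
  ring

theorem inv_apply_eq (M : Matrix (Fin 3) (Fin 3) ℝ) (i j : Fin 3) :
    M⁻¹ i j = M.det⁻¹ * M.adjugate i j := by
  simp [Matrix.inv_def]

theorem adjugate_inv_apply {M : Matrix (Fin 3) (Fin 3) ℝ} (hM : M.det ≠ 0) (i j : Fin 3) :
    M⁻¹.adjugate i j = M.det⁻¹ * M i j := by
  have h1 : M⁻¹⁻¹ = M := Matrix.nonsing_inv_nonsing_inv M hM.isUnit
  have h2 := inv_apply_eq M⁻¹ i j
  rw [h1, Matrix.det_nonsing_inv, Ring.inverse_eq_inv', inv_inv] at h2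
  rw [h2, inv_mul_cancel_left₀ hM]

/-- The determinant of the metric induced on `r = const`. -/
noncomputable def inducedDet (g : Metric3) (x : Coord) : ℝ := g x 1 1 * g x 2 2 - g x 1 2 ^ 2

/-- The part of `R_{τφτφ}` that is linear in the second derivatives of the metric. -/
noncomputable def linearCurvature (g : Metric3) (x : Coord) : ℝ :=
  pd 1 (christoffelLower g 1 2 2) x - pd 2 (christoffelLower g 1 2 1) x

/-- The part of `R_{τφτφ}` quadratic in the Christoffel symbols tangential to `r = const`,
multiplied by the determinant of the induced metric. -/
noncomputable def quadraticCurvature (g : Metric3) (x : Coord) : ℝ :=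
  g x 2 2 * (christoffelLower g 1 1 1 x * christoffelLower g 1 2 2 x
      - christoffelLower g 1 2 1 x * christoffelLower g 1 2 1 x)
    - g x 1 2 * (christoffelLower g 1 1 1 x * christoffelLower g 2 2 2 x
      + christoffelLower g 2 1 1 x * christoffelLower g 1 2 2 x
      - 2 * (christoffelLower g 1 2 1 x * christoffelLower g 2 2 1 x))
    + g x 1 1 * (christoffelLower g 2 1 1 x * christoffelLower g 2 2 2 x
      - christoffelLower g 2 2 1 x * christoffelLower g 2 2 1 x)

/-- The tangential components of the conormal vanish identically, so only `-Γ^r_{AB} n_r` survives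
in the covariant derivative. -/
theorem extrinsicCurvature_eq (g : Metric3) (A B : Fin 2) (x : Coord) :
    extrinsicCurvature g A B x
      = (Real.sqrt ((g x)⁻¹ 0 0))⁻¹ * ∑ m, (g x)⁻¹ 0 m * christoffelLower g m A.succ B.succ x := by
  have h : (fun z => unitNormal g z B.succ) = fun _ => (0 : ℝ) := by
    funext z
    simp [unitNormal]
  rw [extrinsicCurvature, covDeriv, h, pd_const, ← christoffel_eq_sum]
  simp [unitNormal, mul_comm]

namespace IsMetricOn

variable {g : Metric3} {U : Set Coord} {x : Coord}

theorem inv_zero_zero (hg : IsMetricOn g U) (hx : x ∈ U) :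
    (g x)⁻¹ 0 0 = (g x).det⁻¹ * inducedDet g x := by
  rw [inv_apply_eq, Matrix.adjugate_fin_three, inducedDet]
  simp [hg.apply_comm hx 2 1]
  ring_nf
  simp

theorem inv_zero_one (hg : IsMetricOn g U) (hx : x ∈ U) :
    (g x)⁻¹ 0 1 = -(g x).det⁻¹ * (g x 0 1 * g x 2 2 - g x 0 2 * g x 1 2) := by
  rw [inv_apply_eq, Matrix.adjugate_fin_three]
  simp [hg.apply_comm hx 2 1]
  ring

theorem inv_zero_two (hg : IsMetricOn g U) (hx : x ∈ U) :
    (g x)⁻¹ 0 2 = -(g x).det⁻¹ * (g x 0 2 * g x 1 1 - g x 0 1 * g x 1 2) := by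
  rw [inv_apply_eq, Matrix.adjugate_fin_three]
  simp [hg.apply_comm hx 2 1]
  ring

theorem det_eq (hg : IsMetricOn g U) (hx : x ∈ U) :
    (g x).det = g x 0 0 * inducedDet g x - (g x 0 1 ^ 2 * g x 2 2
      - 2 * g x 0 1 * g x 0 2 * g x 1 2 + g x 0 2 ^ 2 * g x 1 1) := by
  rw [Matrix.det_fin_three, inducedDet, hg.apply_comm hx 1 0, hg.apply_comm hx 2 0,
    hg.apply_comm hx 2 1]
  ring

theorem riemannLower_eq (hg : IsMetricOn g U) (hU : IsOpen U) (hx : x ∈ U) {Λ : ℝ}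
    (hE : SolvesEinstein Λ g U) : riemannLower g 1 2 1 2 x = Λ * inducedDet g x := by
  have h := einstein_contraction (P := (g x)⁻¹) (R := fun a i k j => riemannLower g a i k j x)
    (hg.inv_comm hx) (hg.riemannLower_swap_left hU hx)
    (fun a i k j => riemannLower_swap_right g a i k j x)
  simp only [← hg.ricci_eq hU hx] at h
  have hR : ∑ i, ∑ j, (g x)⁻¹ i j * ricci g i j x = scalarCurvature g x := rfl
  rw [hR, Matrix.det_nonsing_inv, Ring.inverse_eq_inv'] at h
  have hd := hg.nondegenerate x hx
  have h2 : ∑ i, (g x)⁻¹ 0 i * ∑ j, g x i j * (g x)⁻¹ j 0 = (g x)⁻¹ 0 0 := by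
    simp [hg.mul_inv_eq hx, Matrix.one_apply]
  -- The field equations with both indices raised, in the `rr` component.
  have h3 : ∑ i, ∑ j, (g x)⁻¹ 0 i * (g x)⁻¹ 0 j * ricci g i j x
      = ((1 / 2) * scalarCurvature g x - Λ) * (g x)⁻¹ 0 0 := by
    rw [← h2, Finset.mul_sum]
    refine Finset.sum_congr rfl fun i _ => ?_
    rw [Finset.mul_sum, Finset.mul_sum]
    refine Finset.sum_congr rfl fun j _ => ?_
    rw [hg.inv_comm hx j 0]
    linear_combination (g x)⁻¹ 0 i * (g x)⁻¹ 0 j * hE x hx i j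
  rw [h3, hg.inv_zero_zero hx] at h
  have h4 : (g x).det⁻¹ * riemannLower g 1 2 1 2 x = (g x).det⁻¹ * (Λ * inducedDet g x) := by
    linear_combination h
  exact mul_left_cancel₀ (inv_ne_zero hd) h4

/-- Since `K_{AB} = Γ^r_{AB} / √g^{rr}`, subtracting `det K` from the quadratic part of `R_{τφτφ}`
replaces `g^{bm}` by `g^{bm} - g^{rb} g^{rm} / g^{rr}`. This Schur complement is the inverse of the
induced metric, so only tangential Christoffel symbols remain. -/
theorem gauss_equation (hg : IsMetricOn g U) (hU : IsOpen U) (hx : x ∈ U) {Λ : ℝ}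
    (hE : SolvesEinstein Λ g U) (h0 : 0 < (g x)⁻¹ 0 0) :
    extrinsicCurvature g 0 0 x * extrinsicCurvature g 1 1 x - extrinsicCurvature g 1 0 x ^ 2
      = linearCurvature g x - Λ * inducedDet g x
        - (inducedDet g x)⁻¹ * quadraticCurvature g x := by
  have hd := hg.nondegenerate x hx
  have hR := hg.riemannLower_eq hU hx hE
  have hP := hg.inv_zero_zero hx
  have hD : inducedDet g x ≠ 0 := fun h => by simp [hP, h] at h0
  have e : (Real.sqrt ((g x)⁻¹ 0 0))⁻¹ * (Real.sqrt ((g x)⁻¹ 0 0))⁻¹ = ((g x)⁻¹ 0 0)⁻¹ := by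
    rw [← mul_inv, Real.mul_self_sqrt h0.le]
  have hp : ((g x)⁻¹ 0 0)⁻¹ * (g x).det⁻¹ = (inducedDet g x)⁻¹ := by
    rw [hP]
    field_simp
  -- The 2 × 2 minors of `g⁻¹` that are the numerators of the Schur complement.
  have m11 := adjugate_inv_apply hd 1 1
  have m12 := adjugate_inv_apply hd 1 2
  have m22 := adjugate_inv_apply hd 2 2
  simp only [Matrix.adjugate_fin_three] at m11 m12 m22
  simp [hg.inv_comm hx 1 0, hg.inv_comm hx 2 0, hg.inv_comm hx 2 1] at m11 m12 m22
  simp only [extrinsicCurvature_eq, Fin.sum_univ_three]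
  simp only [riemannLower, Fin.sum_univ_three, hg.inv_comm hx 1 0, hg.inv_comm hx 2 0,
    hg.inv_comm hx 2 1] at hR
  simp only [linearCurvature, quadraticCurvature, Fin.succ_zero_eq_one, Fin.succ_one_eq_two,
    ← hp]
  set p := (g x)⁻¹
  set s := (Real.sqrt (p 0 0))⁻¹
  have i0 : (p 0 0)⁻¹ * p 0 0 = 1 := inv_mul_cancel₀ h0.ne'
  set q := (p 0 0)⁻¹
  set δ := (g x).det⁻¹
  set c := fun m i j => christoffelLower g m i j x
  change _ = pd 1 (christoffelLower g 1 2 2) x - pd 2 (christoffelLower g 1 2 1) x -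
    Λ * inducedDet g x - q * δ * (
      g x 2 2 * (c 1 1 1 * c 1 2 2 - c 1 2 1 * c 1 2 1)
    - g x 1 2 * (c 1 1 1 * c 2 2 2 + c 2 1 1 * c 1 2 2 - 2 * (c 1 2 1 * c 2 2 1))
    + g x 1 1 * (c 2 1 1 * c 2 2 2 - c 2 2 1 * c 2 2 1))
  change s * (p 0 0 * c 0 1 1 + p 0 1 * c 1 1 1 + p 0 2 * c 2 1 1)
    * (s * (p 0 0 * c 0 2 2 + p 0 1 * c 1 2 2 + p 0 2 * c 2 2 2))
    - (s * (p 0 0 * c 0 2 1 + p 0 1 * c 1 2 1 + p 0 2 * c 2 2 1)) ^ 2 = _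
  let B : Fin 3 → Fin 3 → ℝ := fun b m => c b 1 1 * c m 2 2 - c b 2 1 * c m 2 1
  have hR' : pd 1 (christoffelLower g 1 2 2) x - pd 2 (christoffelLower g 1 2 1) x
      - Λ * inducedDet g x = p 0 0 * B 0 0 + p 0 1 * (B 0 1 + B 1 0) + p 0 2 * (B 0 2 + B 2 0)
        + p 1 1 * B 1 1 + p 1 2 * (B 1 2 + B 2 1) + p 2 2 * B 2 2 := by
    linear_combination hR
  rw [hR']
  simp only [B]
  linear_combination ((p 0 0 * c 0 1 1 + p 0 1 * c 1 1 1 + p 0 2 * c 2 1 1)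
      * (p 0 0 * c 0 2 2 + p 0 1 * c 1 2 2 + p 0 2 * c 2 2 2)
      - (p 0 0 * c 0 2 1 + p 0 1 * c 1 2 1 + p 0 2 * c 2 2 1) ^ 2) * e
    + q * (c 1 1 1 * c 1 2 2 - c 1 2 1 * c 1 2 1) * (-m22)
    + q * (c 1 1 1 * c 2 2 2 + c 2 1 1 * c 1 2 2 - 2 * (c 1 2 1 * c 2 2 1)) * m12
    - q * (c 2 1 1 * c 2 2 2 - c 2 2 1 * c 2 2 1) * m11
    + (p 0 0 * B 0 0 + p 0 1 * (B 0 1 + B 1 0) + p 0 2 * (B 0 2 + B 2 0)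
        + p 1 1 * B 1 1 + p 1 2 * (B 1 2 + B 2 1) + p 2 2 * B 2 2) * i0

theorem extrinsicCurvature_comm (hg : IsMetricOn g U) (hU : IsOpen U) (hx : x ∈ U)
    (A B : Fin 2) : extrinsicCurvature g A B x = extrinsicCurvature g B A x := by
  simp only [extrinsicCurvature_eq, fun m => hg.christoffelLower_comm hU hx m A.succ B.succ]

theorem meanCurvature_eq (hg : IsMetricOn g U) (hU : IsOpen U) (hx : x ∈ U) :
    meanCurvature g x = (inducedDet g x)⁻¹ * (g x 2 2 * extrinsicCurvature g 0 0 x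
      - 2 * (g x 1 2 * extrinsicCurvature g 1 0 x) + g x 1 1 * extrinsicCurvature g 1 1 x) := by
  have hdet : (inducedMetric g x).det = inducedDet g x := by
    simp [Matrix.det_fin_two, inducedMetric, inducedDet, hg.apply_comm hx 2 1]
    ring
  have hi : ∀ A B, (inducedMetric g x)⁻¹ A B
      = (inducedDet g x)⁻¹ * (inducedMetric g x).adjugate A B := fun A B => by
    simp [Matrix.inv_def, hdet]
  simp only [meanCurvature, hi, Matrix.adjugate_fin_two, Fin.sum_univ_two]
  simp [inducedMetric, hg.apply_comm hx 2 1, hg.extrinsicCurvature_comm hU hx 0 1]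
  ring

end IsMetricOn

/-! ### Calculus of fall-off conditions -/

/-- The filter of neighbourhoods of `r = ∞`, uniformly in the boundary points of `T`. -/
def infinity (T : Set BCoord) : Filter Coord :=
  map (fun p : ℝ × BCoord => point p.1 p.2) (atTop ×ˢ 𝓟 T)

variable {T : Set BCoord} {f f' : Coord → ℝ} {m n k : ℤ}

theorem fallsBigO_iff : FallsBigO T f n ↔ f =O[infinity T] fun x => x 0 ^ n := by
  rw [infinity, isBigO_map]
  rfl

theorem fallsLittleO_iff : FallsLittleO T f n ↔ f =o[infinity T] fun x => x 0 ^ n := by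
  rw [infinity, isLittleO_map]
  rfl

theorem eventually_infinity {p : Coord → Prop} {r₀ : ℝ}
    (h : ∀ r > r₀, ∀ y ∈ T, p (point r y)) : ∀ᶠ x in infinity T, p x := by
  rw [infinity, eventually_map]
  have := (eventually_gt_atTop r₀).prod_mk (eventually_mem_set.2 (mem_principal_self T))
  filter_upwards [this] with q hq using h q.1 hq.1 q.2 hq.2

theorem tendsto_radial (T : Set BCoord) : Tendsto (fun x : Coord => x 0) (infinity T) atTop := by
  rw [infinity, tendsto_map'_iff]
  exact tendsto_fst

theorem radial_pos (T : Set BCoord) : ∀ᶠ x in infinity T, 0 < x 0 :=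
  (tendsto_radial T).eventually_gt_atTop 0

theorem tendsto_point {y : BCoord} (hy : y ∈ T) :
    Tendsto (fun r => point r y) atTop (infinity T) := by
  have h : Tendsto (fun r : ℝ => (r, y)) atTop (atTop ×ˢ 𝓟 T) :=
    tendsto_id.prodMk (tendsto_principal.2 (Eventually.of_forall fun _ => hy))
  exact tendsto_map.comp h

namespace FallsBigO

theorem congr (h : FallsBigO T f n) (e : ∀ᶠ x in infinity T, f' x = f x) : FallsBigO T f' n := by
  rw [fallsBigO_iff] at *
  exact h.congr' (e.mono fun x hx => hx.symm) EventuallyEq.rfl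

theorem mono (h : FallsBigO T f m) (hmn : m ≤ n := by norm_num) : FallsBigO T f n := by
  rw [fallsBigO_iff] at *
  refine h.trans (IsBigO.of_bound 1 ?_)
  filter_upwards [(tendsto_radial T).eventually_ge_atTop 1] with x hx
  have hx0 : 0 < x 0 := zero_lt_one.trans_le hx
  rw [one_mul, Real.norm_of_nonneg (zpow_pos hx0 _).le, Real.norm_of_nonneg (zpow_pos hx0 _).le]
  exact zpow_le_zpow_right₀ hx hmn

theorem add (h : FallsBigO T f n) (h' : FallsBigO T f' n) :
    FallsBigO T (fun x => f x + f' x) n := by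
  rw [fallsBigO_iff] at *
  exact h.add h'

theorem sub (h : FallsBigO T f n) (h' : FallsBigO T f' n) :
    FallsBigO T (fun x => f x - f' x) n := by
  rw [fallsBigO_iff] at *
  exact h.sub h'

theorem const_mul (h : FallsBigO T f n) (c : ℝ) : FallsBigO T (fun x => c * f x) n := by
  rw [fallsBigO_iff] at *
  exact h.const_mul_left c

theorem mul (h : FallsBigO T f m) (h' : FallsBigO T f' n) (hk : m + n ≤ k := by norm_num) :
    FallsBigO T (fun x => f x * f' x) k := by
  refine mono ?_ hk
  rw [fallsBigO_iff] at *
  refine (h.mul h').congr' EventuallyEq.rfl ?_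
  filter_upwards [radial_pos T] with x hx using (zpow_add₀ hx.ne' m n).symm

theorem radial_zpow (T : Set BCoord) (n : ℤ) : FallsBigO T (fun x => x 0 ^ n) n := by
  rw [fallsBigO_iff]

theorem radial_pow (T : Set BCoord) (n : ℕ) : FallsBigO T (fun x => x 0 ^ n) n := by
  simpa using radial_zpow T n

theorem littleO (h : FallsBigO T f m) (hmn : m < n := by norm_num) : FallsLittleO T f n := by
  rw [fallsBigO_iff] at h
  rw [fallsLittleO_iff]
  refine h.trans_isLittleO ?_
  have h1 : (fun x : Coord => (1 : ℝ)) =o[infinity T] fun x => x 0 ^ (n - m) := by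
    rw [isLittleO_one_left_iff ℝ]
    exact tendsto_norm_atTop_atTop.comp
      ((tendsto_zpow_atTop_atTop (sub_pos.2 hmn)).comp (tendsto_radial T))
  refine ((isBigO_refl (fun x : Coord => x 0 ^ m) (infinity T)).mul_isLittleO h1).congr' ?_ ?_
  · exact Eventually.of_forall fun x => mul_one _
  · filter_upwards [radial_pos T] with x hx
    rw [← zpow_add₀ hx.ne']
    congr 1
    ring

theorem isEquivalent {c : ℝ} (hc : c ≠ 0) (h : FallsBigO T (fun x => f x - c * x 0 ^ n) m)
    (hmn : m < n := by norm_num) : f ~[infinity T] fun x => c * x 0 ^ n := by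
  have h1 := h.littleO hmn
  rw [fallsLittleO_iff] at h1
  exact h1.trans_isBigO (isBigO_self_const_mul hc _ _)

theorem inv {c : ℝ} (hc : c ≠ 0) (h : FallsBigO T (fun x => f x - c * x 0 ^ n) m)
    (hmn : m < n := by norm_num) : FallsBigO T (fun x => (f x)⁻¹) (-n) := by
  have h1 := (h.isEquivalent hc hmn).inv.isBigO
  rw [fallsBigO_iff]
  refine h1.trans ?_
  have e : (fun x : Coord => c * x 0 ^ n)⁻¹ = fun x => c⁻¹ * x 0 ^ (-n) := by
    funext x
    simp [mul_comm]
  rw [e]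
  exact isBigO_const_mul_self _ _ _

end FallsBigO

theorem eventually_pos_of_fallsBigO {c : ℝ} (hc : 0 < c)
    (h : FallsBigO T (fun x => f x - c * x 0 ^ n) m) (hmn : m < n := by norm_num) :
    ∀ᶠ x in infinity T, 0 < f x := by
  have h1 := h.littleO hmn
  rw [fallsLittleO_iff] at h1
  filter_upwards [h1.bound (half_pos hc), radial_pos T] with x hx h0
  have h2 := zpow_pos h0 n
  rw [Real.norm_of_nonneg h2.le] at hx
  have h3 := (abs_le.1 hx).1
  nlinarith [mul_pos hc h2]

/-! ### Asymptotics of Brown-Henneaux solutions -/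

/-- A solution of Einstein's equations with Brown-Henneaux boundary conditions at `T`. -/
structure BHSolution (l : ℝ) (U : Set Coord) (T : Set BCoord) (g : Metric3) : Prop where
  pos : 0 < l
  isOpen : IsOpen U
  mem : ∀ᶠ x in infinity T, x ∈ U
  metric : IsMetricOn g U
  einstein : SolvesEinstein (-1 / l ^ 2) g U
  falloff : BrownHenneaux l flatMetric T g

theorem hasFDerivAt_radial (x : Coord) :
    HasFDerivAt (fun z : Coord => z 0) (ContinuousLinearMap.proj 0 : Coord →L[ℝ] ℝ) x :=
  hasFDerivAt_apply 0 x

theorem pd_radial_sq_mul (i : Fin 3) (c : ℝ) (x : Coord) :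
    pd i (fun z => z 0 ^ 2 * c) x = 2 * x 0 * c * (Pi.single i 1 : Coord) 0 := by
  have h := (((hasFDerivAt_radial x).pow 2).mul_const c).fderiv
  rw [pd, h]
  simp
  ring

/-! ### Orders in `r` of the geometric quantities, and the decay of `K - ₀K` -/

namespace BHSolution

variable {l : ℝ} {U : Set Coord} {T : Set BCoord} {g : Metric3}

theorem tangential_pd (h : BHSolution l U T g) (i : Fin 3) (A B : Fin 2) :
    FallsBigO T (fun x => pd i (fun z => g z A.succ B.succ) x
      - 2 * x 0 * flatMetric 0 A B * (Pi.single i 1 : Coord) 0) (-weight i) := by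
  refine (((h.falloff.tangential A B).one i).mono (by simp)).congr ?_
  filter_upwards [h.mem] with x hx
  rw [← pd_radial_sq_mul]
  refine (pd_sub (h.metric.differentiableAt h.isOpen hx _ _) ?_).symm
  exact ((hasFDerivAt_radial x).differentiableAt.pow 2).mul_const _

/-- The leading term `r² γbar` depends on `r` alone, so a tangential derivative removes it and
leaves the `O₂(1)` remainder. -/
theorem tangential_pd_pd (h : BHSolution l U T g) (i : Fin 3) {j : Fin 3} (hj : j ≠ 0)
    (A B : Fin 2) : FallsBigO T (pd i (pd j fun z => g z A.succ B.succ)) (-weight i) := by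
  refine (((h.falloff.tangential A B).two i j).mono (by simp [weight, hj])).congr ?_
  filter_upwards [h.mem] with x hx
  refine pd_congr ?_
  filter_upwards [h.isOpen.mem_nhds hx] with y hy
  have e := pd_sub (i := j) (f' := fun z => z 0 ^ 2 * flatMetric 0 A B)
    (h.metric.differentiableAt h.isOpen hy A.succ B.succ)
    (((hasFDerivAt_radial y).differentiableAt.pow 2).mul_const _)
  rw [pd_radial_sq_mul, Pi.single_eq_of_ne hj.symm, mul_zero, sub_zero] at e
  exact e.symm

theorem tangential (h : BHSolution l U T g) (A B : Fin 2) :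
    FallsBigO T (fun x => g x A.succ B.succ - x 0 ^ 2 * flatMetric 0 A B) 0 :=
  (h.falloff.tangential A B).zero

theorem fallsBigO_tangential (h : BHSolution l U T g) (A B : Fin 2) :
    FallsBigO T (fun x => g x A.succ B.succ) 2 := by
  refine (((h.tangential A B).mono (n := 2)).add
    ((FallsBigO.radial_zpow T 2).const_mul (flatMetric 0 A B))).congr
      (Eventually.of_forall fun x => ?_)
  simp only [zpow_ofNat]
  ring

theorem christoffelLower_tangential (h : BHSolution l U T g) (C A B : Fin 2) :
    FallsBigO T (christoffelLower g C.succ A.succ B.succ) 0 := by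
  have hs : ∀ A B C : Fin 2, FallsBigO T (pd C.succ (fun z => g z A.succ B.succ)) 0 :=
    fun A B C => by simpa [weight, Fin.succ_ne_zero] using h.tangential_pd C.succ A B
  exact (((hs _ _ _).add (hs _ _ _)).sub (hs _ _ _)).const_mul _

theorem pd_mixed (h : BHSolution l U T g) (A B : Fin 2) :
    FallsBigO T (pd A.succ (fun z => g z 0 B.succ)) (-3) :=
  ((h.falloff.mixed B).one A.succ).mono (by simp [weight, Fin.succ_ne_zero])

theorem christoffelLower_radial_add (h : BHSolution l U T g) (A B : Fin 2) :
    FallsBigO T (fun x => christoffelLower g 0 A.succ B.succ x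
      + (1 / 2) * pd 0 (fun z => g z A.succ B.succ) x) (-3) :=
  ((((h.pd_mixed A B).add (h.pd_mixed B A))).const_mul (1 / 2)).congr
    (Eventually.of_forall fun x => by rw [christoffelLower]; ring)

theorem christoffelLower_radial (h : BHSolution l U T g) (A B : Fin 2) :
    FallsBigO T (fun x => christoffelLower g 0 A.succ B.succ x
      + x 0 * flatMetric 0 A B) (-1) := by
  have h1 := ((h.tangential_pd 0 A B).mono (n := -1) (by simp [weight])).const_mul (-(1 / 2))
  refine (((h.christoffelLower_radial_add A B).mono (n := -1)).add h1).congr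
    (Eventually.of_forall fun x => ?_)
  simp only [Pi.single_eq_same]
  ring

theorem linearCurvature (h : BHSolution l U T g) : FallsBigO T (linearCurvature g) 0 := by
  have hs : ∀ A B C D : Fin 2,
      FallsBigO T (pd D.succ (pd C.succ (fun z => g z A.succ B.succ))) 0 := fun A B C D => by
    simpa [weight, Fin.succ_ne_zero] using h.tangential_pd_pd D.succ (Fin.succ_ne_zero C) A B
  have hc : ∀ A B C D : Fin 2,
      FallsBigO T (pd D.succ (christoffelLower g C.succ A.succ B.succ)) 0 := fun A B C D =>
    ((((hs C B A D).add (hs C A B D)).sub (hs A B C D)).const_mul (1 / 2)).congr <| by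
      filter_upwards [h.mem] with x hx using h.metric.pd_christoffelLower h.isOpen hx _ _ _ _
  exact (hc 1 1 0 0).sub (hc 1 0 0 1)

theorem quadraticCurvature (h : BHSolution l U T g) :
    FallsBigO T (quadraticCurvature g) 2 := by
  have c := fun C A B : Fin 2 => h.christoffelLower_tangential C A B
  have cc : ∀ C A B C' A' B' : Fin 2, FallsBigO T (fun x =>
      christoffelLower g C.succ A.succ B.succ x * christoffelLower g C'.succ A'.succ B'.succ x) 0 :=
    fun C A B C' A' B' => (c C A B).mul (c C' A' B')
  have t := h.fallsBigO_tangential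
  have h1 : FallsBigO T _ 2 := (t 1 1).mul ((cc 0 0 0 0 1 1).sub (cc 0 1 0 0 1 0))
  have h2 : FallsBigO T _ 2 := (t 0 1).mul (((cc 0 0 0 1 1 1).add (cc 1 0 0 0 1 1)).sub
    ((cc 0 1 0 1 1 0).const_mul 2))
  have h3 : FallsBigO T _ 2 := (t 0 0).mul ((cc 1 0 0 1 1 1).sub (cc 1 1 0 1 1 0))
  exact (h1.sub h2).add h3

theorem inducedDet_add (h : BHSolution l U T g) :
    FallsBigO T (fun x => inducedDet g x - (-1) * x 0 ^ (4 : ℤ)) 2 := by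
  have h11 := h.tangential 0 0
  have h12 := h.tangential 0 1
  have h22 := h.tangential 1 1
  have a1 : FallsBigO T _ 2 := h11.mul (h.fallsBigO_tangential 1 1)
  have a2 : FallsBigO T _ 2 := (FallsBigO.radial_pow T 2).mul h22
  have a3 : FallsBigO T _ 2 := h12.mul h12
  -- `g₁₁ g₂₂ + r⁴ = (g₁₁ + r²) g₂₂ - r² (g₂₂ - r²)`.
  refine ((a1.sub a2).sub a3).congr (Eventually.of_forall fun x => ?_)
  simp [inducedDet, flatMetric]
  ring

theorem inducedDet_inv (h : BHSolution l U T g) :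
    FallsBigO T (fun x => (inducedDet g x)⁻¹) (-4) :=
  h.inducedDet_add.inv (by norm_num)

theorem inducedDet_ne_zero (h : BHSolution l U T g) :
    ∀ᶠ x in infinity T, inducedDet g x ≠ 0 := by
  have h1 : FallsBigO T (fun x => (-1) * inducedDet g x - 1 * x 0 ^ (4 : ℤ)) 2 :=
    (h.inducedDet_add.const_mul (-1)).congr (Eventually.of_forall fun x => by ring)
  filter_upwards [eventually_pos_of_fallsBigO one_pos h1] with x hx h0
  simp [h0] at hx

/-- The square of the lapse function of the foliation by `r = const`. -/
noncomputable def lapseSq (g : Metric3) (x : Coord) : ℝ :=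
  g x 0 0 - (inducedDet g x)⁻¹ * (g x 0 1 * (g x 0 1 * g x 2 2 - g x 0 2 * g x 1 2)
    + g x 0 2 * (g x 0 2 * g x 1 1 - g x 0 1 * g x 1 2))

/-- These are the shift components `h^{AB} g_{rB}`; the order is `-4 - 3 + 2`. -/
theorem shift (h : BHSolution l U T g) :
    FallsBigO T (fun x => (inducedDet g x)⁻¹ * (g x 0 1 * g x 2 2 - g x 0 2 * g x 1 2)) (-5) ∧
    FallsBigO T (fun x => (inducedDet g x)⁻¹ * (g x 0 2 * g x 1 1 - g x 0 1 * g x 1 2)) (-5) := by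
  have t := h.fallsBigO_tangential
  have m := fun A => (h.falloff.mixed A).zero
  have a1 : FallsBigO T _ (-1) := (m 0).mul (t 1 1)
  have a2 : FallsBigO T _ (-1) := (m 1).mul (t 0 1)
  have a3 : FallsBigO T _ (-1) := (m 1).mul (t 0 0)
  have a4 : FallsBigO T _ (-1) := (m 0).mul (t 0 1)
  exact ⟨h.inducedDet_inv.mul (a1.sub a2), h.inducedDet_inv.mul (a3.sub a4)⟩

theorem lapseSq_sub (h : BHSolution l U T g) :
    FallsBigO T (fun x => lapseSq g x - g x 0 0) (-8) := by
  have m := fun A => (h.falloff.mixed A).zero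
  have a1 : FallsBigO T _ (-8) := (m 0).mul h.shift.1
  have a2 : FallsBigO T _ (-8) := (m 1).mul h.shift.2
  refine ((a1.add a2).const_mul (-1)).congr (Eventually.of_forall fun x => ?_)
  simp only [lapseSq, Fin.succ_zero_eq_one, Fin.succ_one_eq_two]
  ring

theorem lapseSq_falloff (h : BHSolution l U T g) :
    FallsBigO T (fun x => lapseSq g x - l ^ 2 * x 0 ^ (-2 : ℤ)) (-4) := by
  refine ((h.lapseSq_sub.mono (n := -4)).add h.falloff.radial.zero).congr
    (Eventually.of_forall fun x => ?_)
  rw [zpow_neg, zpow_ofNat]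
  ring

theorem lapseSq_pos (h : BHSolution l U T g) : ∀ᶠ x in infinity T, 0 < lapseSq g x :=
  eventually_pos_of_fallsBigO (pow_pos h.pos 2) h.lapseSq_falloff

theorem lapseSq_inv_sub (h : BHSolution l U T g) :
    FallsBigO T (fun x => (lapseSq g x)⁻¹ - x 0 ^ 2 / l ^ 2) 0 := by
  have h1 := h.lapseSq_falloff.inv (pow_pos h.pos 2).ne'
  have h2 : FallsBigO T _ (-2) := h.lapseSq_falloff.mul h1
  have h3 : FallsBigO T _ 0 := h2.mul (FallsBigO.radial_pow T 2)
  refine (h3.const_mul (-(1 / l ^ 2))).congr ?_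
  filter_upwards [h.lapseSq_pos, radial_pos T] with x hx hr
  have := h.pos
  rw [zpow_neg, zpow_ofNat]
  field_simp
  ring

theorem inv_zero_zero (h : BHSolution l U T g) :
    ∀ᶠ x in infinity T, (g x)⁻¹ 0 0 = (lapseSq g x)⁻¹ := by
  filter_upwards [h.mem, h.inducedDet_ne_zero] with x hx hD
  have e : (g x).det = lapseSq g x * inducedDet g x := by
    rw [h.metric.det_eq hx, lapseSq]
    field_simp
    ring
  rw [h.metric.inv_zero_zero hx, e]
  field_simp

/-- The inverse of the lapse function. -/
noncomputable def invLapse (g : Metric3) (x : Coord) : ℝ := Real.sqrt (lapseSq g x)⁻¹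

/-- A difference of squares of order `0` is divided by the sum of the roots, which is at least `r /
l`. -/
theorem invLapse_sub (h : BHSolution l U T g) :
    FallsBigO T (fun x => invLapse g x - x 0 / l) (-1) := by
  have hl := h.pos
  have h1 : FallsBigO T (fun x => (invLapse g x + x 0 / l)⁻¹) (-1) := by
    have h2 := (FallsBigO.radial_zpow T (-1)).const_mul l
    rw [fallsBigO_iff] at *
    refine IsBigO.trans (IsBigO.of_bound 1 ?_) h2
    filter_upwards [radial_pos T] with x hr
    have hw : 0 ≤ invLapse g x := Real.sqrt_nonneg _
    have hq : 0 < x 0 / l := div_pos hr hl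
    have e : l * x 0 ^ (-1 : ℤ) = (x 0 / l)⁻¹ := by
      rw [zpow_neg_one]
      field_simp
    rw [one_mul, e, norm_inv, norm_inv, Real.norm_of_nonneg hq.le,
      Real.norm_of_nonneg (by positivity)]
    exact inv_anti₀ hq (by linarith)
  have h2 : FallsBigO T _ (-1) := h.lapseSq_inv_sub.mul h1
  refine h2.congr ?_
  filter_upwards [radial_pos T, h.lapseSq_pos] with x hr hx
  have hw : 0 ≤ invLapse g x := Real.sqrt_nonneg _
  have hq : 0 < x 0 / l := div_pos hr hl
  have e : (lapseSq g x)⁻¹ = invLapse g x ^ 2 := (Real.sq_sqrt (inv_pos.2 hx).le).symm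
  rw [e, ← div_pow, sq_sub_sq, mul_comm (invLapse g x + _), mul_assoc,
    mul_inv_cancel₀ (by positivity), mul_one]

theorem fallsBigO_invLapse (h : BHSolution l U T g) : FallsBigO T (invLapse g) 1 := by
  refine ((h.invLapse_sub.mono (n := 1)).add ((FallsBigO.radial_zpow T 1).const_mul l⁻¹)).congr
    (Eventually.of_forall fun x => ?_)
  rw [zpow_one]
  ring

/-- In lapse-shift form, `E` is minus the shift contracted with the tangential Christoffel symbols,
which are `O(1)`. -/
theorem extrinsicCurvature_eq (h : BHSolution l U T g) (A B : Fin 2) :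
    ∃ E : Coord → ℝ, FallsBigO T E (-5) ∧ ∀ᶠ x in infinity T, extrinsicCurvature g A B x
      = invLapse g x * (christoffelLower g 0 A.succ B.succ x + E x) := by
  have c := fun C => h.christoffelLower_tangential C A B
  have a1 : FallsBigO T _ (-5) := h.shift.1.mul (c 0)
  have a2 : FallsBigO T _ (-5) := h.shift.2.mul (c 1)
  refine ⟨_, (a1.add a2).const_mul (-1), ?_⟩
  filter_upwards [h.mem, h.inducedDet_ne_zero, h.lapseSq_pos, h.inv_zero_zero]
    with x hx hD hN h0
  have e := h.metric.inv_zero_zero hx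
  rw [h0] at e
  have hw : invLapse g x ^ 2 = (lapseSq g x)⁻¹ := Real.sq_sqrt (inv_pos.2 hN).le
  have hw0 : 0 < invLapse g x := Real.sqrt_pos.2 (inv_pos.2 hN)
  have e2 : (g x).det⁻¹ = invLapse g x ^ 2 * (inducedDet g x)⁻¹ := by
    rw [hw, e, mul_assoc, mul_inv_cancel₀ hD, mul_one]
  rw [AdS3.extrinsicCurvature_eq, Fin.sum_univ_three, h.metric.inv_zero_one hx,
    h.metric.inv_zero_two hx, h0, e2]
  have e3 : Real.sqrt (lapseSq g x)⁻¹ = invLapse g x := rfl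
  rw [e3, ← hw]
  simp only [Fin.succ_zero_eq_one, Fin.succ_one_eq_two]
  field_simp
  ring

/-- The deviation of the extrinsic curvature from its value `-h_{AB} / l` in anti-de Sitter
space. -/
noncomputable def deviation (l : ℝ) (g : Metric3) (A B : Fin 2) (x : Coord) : ℝ :=
  extrinsicCurvature g A B x + g x A.succ B.succ / l

/-- The growing parts cancel: `K_{AB}` behaves as `(r/l)(-r γbar_{AB})`, which is the leading part
of `-h_{AB}/l`. -/
theorem fallsBigO_deviation (h : BHSolution l U T g) (A B : Fin 2) :
    FallsBigO T (deviation l g A B) 0 := by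
  have hl := h.pos
  obtain ⟨E, hE, e⟩ := h.extrinsicCurvature_eq A B
  have h1 := (h.christoffelLower_radial A B).add (hE.mono (n := -1))
  have h2 : FallsBigO T _ 0 := h.fallsBigO_invLapse.mul h1
  have h3 : FallsBigO T _ 0 := h.invLapse_sub.mul (FallsBigO.radial_zpow T 1)
  refine ((h2.sub (h3.const_mul (flatMetric 0 A B))).add
    ((h.tangential A B).const_mul l⁻¹)).congr ?_
  filter_upwards [e] with x hx
  rw [deviation, hx, zpow_one]
  ring

/-- Gauss's equation, solved for the part linear in `L`, reads `K - ₀K = (l / det h)(det L - lin +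
quad / det h)`, where `lin` and `quad` are the two curvature parts; the last bracket is `O(1)`. -/
theorem fallsBigO_meanCurvature (h : BHSolution l U T g) :
    FallsBigO T (fun x => meanCurvature g x - K₀ l) (-4) := by
  have hl := h.pos
  have L := h.fallsBigO_deviation
  have h1 : FallsBigO T _ 0 := (L 0 0).mul (L 1 1)
  have h2 : FallsBigO T _ 0 := (L 1 0).mul (L 1 0)
  have h3 : FallsBigO T _ 0 := h.inducedDet_inv.mul h.quadraticCurvature
  have h4 : FallsBigO T _ (-4) :=
    h.inducedDet_inv.mul (((h1.sub h2).sub h.linearCurvature).add h3)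
  refine (h4.const_mul l).congr ?_
  filter_upwards [h.mem, h.inducedDet_ne_zero, h.inv_zero_zero, h.lapseSq_pos] with x hx hD h0 hN
  have G := h.metric.gauss_equation h.isOpen hx h.einstein (h0 ▸ inv_pos.2 hN)
  have e : AdS3.linearCurvature g x
      - (inducedDet g x)⁻¹ * AdS3.quadraticCurvature g x = extrinsicCurvature g 0 0 x *
        extrinsicCurvature g 1 1 x - extrinsicCurvature g 1 0 x ^ 2 - inducedDet g x / l ^ 2 := by
    rw [G]
    ring
  have e2 : ∀ a b c d : ℝ, a - b - c + d = a - b - (c - d) := fun a b c d => by ring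
  rw [e2, e, h.metric.meanCurvature_eq h.isOpen hx, K₀]
  simp only [deviation, Fin.succ_zero_eq_one, Fin.succ_one_eq_two, h.metric.apply_comm hx 2 1]
  have hD2 : inducedDet g x = g x 1 1 * g x 2 2 - g x 1 2 ^ 2 := rfl
  field_simp
  rw [hD2]
  ring

end BHSolution

/-! ### The radial equation for the flat trace of the induced metric -/

namespace BHSolution

variable {l : ℝ} {U : Set Coord} {T : Set BCoord} {g : Metric3}

/-- `det h · (K - ₀K)` is the cofactor contraction of `h` with `L`. It is `O(1)`, and replacing `h`
by `r² γbar` costs only `O(1)`, so `r² (L_{ττ} - L_{φφ})` is bounded. -/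
theorem deviation_trace (h : BHSolution l U T g) :
    FallsBigO T (fun x => deviation l g 0 0 x - deviation l g 1 1 x) (-2) := by
  have hl := h.pos
  have L := h.fallsBigO_deviation
  have hD : FallsBigO T (inducedDet g) 4 :=
    ((h.inducedDet_add.mono (n := 4)).add ((FallsBigO.radial_zpow T 4).const_mul (-1))).congr
      (Eventually.of_forall fun x => by ring)
  have h1 : FallsBigO T _ 0 := hD.mul h.fallsBigO_meanCurvature
  have h2 : FallsBigO T _ 0 := (h.tangential 1 1).mul (L 0 0)
  have h3 : FallsBigO T _ 0 := (h.tangential 0 0).mul (L 1 1)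
  have h4 : FallsBigO T _ 0 := (h.tangential 0 1).mul (L 1 0)
  have h5 : FallsBigO T _ (-2) :=
    (FallsBigO.radial_zpow T (-2)).mul (((h1.sub h2).sub h3).add (h4.const_mul 2))
  refine h5.congr ?_
  filter_upwards [h.mem, h.inducedDet_ne_zero, radial_pos T] with x hx hD0 hr
  have e : inducedDet g x * (meanCurvature g x - K₀ l) = g x 2 2 * deviation l g 0 0 x
      - 2 * (g x 1 2 * deviation l g 1 0 x) + g x 1 1 * deviation l g 1 1 x := by
    have hD2 : inducedDet g x = g x 1 1 * g x 2 2 - g x 1 2 ^ 2 := rfl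
    rw [h.metric.meanCurvature_eq h.isOpen hx, K₀]
    simp only [deviation, Fin.succ_zero_eq_one, Fin.succ_one_eq_two, h.metric.apply_comm hx 2 1]
    field_simp
    rw [hD2]
    ring
  rw [e, zpow_neg, zpow_ofNat]
  simp only [flatMetric, Fin.succ_zero_eq_one, Fin.succ_one_eq_two, Matrix.of_apply,
    Matrix.cons_val', Matrix.cons_val_zero, Matrix.cons_val_one, Matrix.cons_val_fin_one]
  field_simp
  ring

theorem radial_pd_trace (h : BHSolution l U T g) :
    FallsBigO T (fun x => (1 / 2) * invLapse g x * (pd 0 (fun z => g z 2 2) x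
      - pd 0 (fun z => g z 1 1) x) - (g x 2 2 - g x 1 1) / l) (-2) := by
  obtain ⟨E, hE, e⟩ := h.extrinsicCurvature_eq 0 0
  obtain ⟨E', hE', e'⟩ := h.extrinsicCurvature_eq 1 1
  have s := h.christoffelLower_radial_add
  have h1 := ((hE.mono (n := -3)).sub (hE'.mono (n := -3))).add ((s 0 0).sub (s 1 1))
  have h2 : FallsBigO T _ (-2) := h.fallsBigO_invLapse.mul h1
  refine (h.deviation_trace.sub h2).congr ?_
  filter_upwards [e, e'] with x hx hx'
  simp only [deviation, hx, hx', Fin.succ_zero_eq_one, Fin.succ_one_eq_two]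
  ring

/-- The trace of the radial derivative of the induced metric is determined, to second
subleading order, by the metric itself. -/
theorem radial_pd_trace_eq (h : BHSolution l U T g) :
    FallsBigO T (fun x => (1 / 2) * x 0 * (pd 0 (fun z => g z 2 2) x
      - pd 0 (fun z => g z 1 1) x) - (g x 2 2 - g x 1 1)
      - x 0 ^ 4 / l ^ 2 * (g x 0 0 - l ^ 2 / x 0 ^ 2)) (-2) := by
  have hl := h.pos
  -- `ε` and `κ` are the relative corrections to the inverse lapse `r / l` and to the squared lapse
  -- `l² / r²`; `d` is the trace derivative without its leading part `2r²`.
  let ε : Coord → ℝ := fun x => l * x 0 ^ (-1 : ℤ) * (invLapse g x - x 0 / l)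
  let κ : Coord → ℝ := fun x => x 0 ^ 2 / l ^ 2 * (lapseSq g x - l ^ 2 * x 0 ^ (-2 : ℤ))
  let d : Coord → ℝ := fun x => (1 / 2) * x 0 * (pd 0 (fun z => g z 2 2) x
      - pd 0 (fun z => g z 1 1) x) - 2 * x 0 ^ 2
  have hε : FallsBigO T ε (-2) := by
    have := ((FallsBigO.radial_zpow T (-1)).const_mul l)
    exact this.mul h.invLapse_sub
  have hκ : FallsBigO T κ (-2) := by
    have := ((FallsBigO.radial_pow T 2).const_mul (l ^ 2)⁻¹)
    exact (this.mul h.lapseSq_falloff).congr (Eventually.of_forall fun x => by simp only [κ]; ring)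
  have hd : FallsBigO T d 0 := by
    have h1 := (h.tangential_pd 0 1 1).mono (n := -1) (by simp [weight])
    have h2 := (h.tangential_pd 0 0 0).mono (n := -1) (by simp [weight])
    have h3 : FallsBigO T _ 0 := (FallsBigO.radial_zpow T 1).mul ((h1.sub h2).const_mul (1 / 2))
    refine h3.congr (Eventually.of_forall fun x => ?_)
    simp [d, flatMetric]
    ring
  have t1 : FallsBigO T _ (-2) := hε.mul hd
  have t2 : FallsBigO T _ (-4) := hε.mul hε
  have t3 : FallsBigO T _ (-4) := hε.mul hκ
  have t4 : FallsBigO T _ (-4) := t2.mul hκ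
  have t5 : FallsBigO T _ (-2) :=
    (FallsBigO.radial_pow T 2).mul ((t2.add (t3.const_mul 2)).add t4)
  have t6 : FallsBigO T _ (-2) := (FallsBigO.radial_pow T 4).mul h.lapseSq_sub
  refine ((((h.radial_pd_trace.const_mul l).sub t1).add t5).add
    ((t6.mono (n := -2)).const_mul (l ^ 2)⁻¹)).congr ?_
  filter_upwards [radial_pos T, h.lapseSq_pos] with x hr hN
  have hw : invLapse g x ^ 2 * lapseSq g x = 1 := by
    rw [invLapse, Real.sq_sqrt (inv_pos.2 hN).le, inv_mul_cancel₀ hN.ne']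
  have e1 : (1 + ε x) = l * invLapse g x / x 0 := by
    simp only [ε, zpow_neg_one]
    field_simp
    ring
  have e2 : (1 + κ x) = x 0 ^ 2 * lapseSq g x / l ^ 2 := by
    simp only [κ, zpow_neg, zpow_ofNat]
    field_simp
    ring
  -- Hence `2ε = -κ` up to terms of order `r⁻⁴`, so that `2r² ε` contributes the `g_{rr}` correction
  -- `-r² κ` up to `O(r⁻²)`.
  have e3 : (1 + ε x) ^ 2 * (1 + κ x) = 1 := by
    rw [e1, e2, ← hw]
    field_simp
  have e4 : ε x * ε x + 2 * (ε x * κ x) + ε x * ε x * κ x = -(2 * ε x + κ x) := by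
    linear_combination e3
  rw [e4]
  have e5 : invLapse g x = x 0 / l * (1 + ε x) := by
    rw [e1]
    field_simp
  have e6 : lapseSq g x = l ^ 2 / x 0 ^ 2 * (1 + κ x) := by
    rw [e2]
    field_simp
  rw [e5, e6]
  simp only [d]
  field_simp
  ring

end BHSolution

/-! ### Limits along the lines of constant `(τ, φ)` -/

/-- The mean value theorem on `[r, 2r]` gives `r u'(ξ) = u(2r) - u(r)`, which tends to `0`. As `ξ /
r` stays in `[1, 2]`, `ξ u'(ξ)` tends to `0` as well, while it must tend to `L`. -/
theorem eq_zero_of_tendsto_mul_deriv {u u' : ℝ → ℝ} {c L : ℝ} (hu : Tendsto u atTop (𝓝 c))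
    (hd : ∀ᶠ r in atTop, HasDerivAt u (u' r) r)
    (h : Tendsto (fun r => r * u' r) atTop (𝓝 L)) : L = 0 := by
  obtain ⟨R, hR⟩ := eventually_atTop.1 hd
  have key : ∀ r, ∃ ξ, max R 1 ≤ r → r ≤ ξ ∧ ξ ≤ 2 * r ∧ u (2 * r) - u r = u' ξ * r := fun r => by
    by_cases hr : max R 1 ≤ r
    · have hR1 := (le_max_left R 1).trans hr
      have h1 := (le_max_right R 1).trans hr
      obtain ⟨ξ, hξ, e⟩ := exists_hasDerivAt_eq_slope u u' (show r < 2 * r by linarith)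
        (fun z hz => (hR z (hR1.trans hz.1)).continuousAt.continuousWithinAt)
        (fun z hz => hR z (hR1.trans hz.1.le))
      refine ⟨ξ, fun _ => ⟨hξ.1.le, hξ.2.le, ?_⟩⟩
      rw [e]
      field_simp
      ring
    -- A dummy value, so that `ξ` is a total function of `r`.
    · exact ⟨0, fun hr' => absurd hr' hr⟩
  choose ξ hξ using key
  have hξt : Tendsto ξ atTop atTop := by
    refine tendsto_atTop_mono' _ ?_ tendsto_id
    filter_upwards [eventually_ge_atTop (max R 1)] with r hr using (hξ r hr).1
  have h1 : Tendsto (fun r => u (2 * r) - u r) atTop (𝓝 0) := by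
    have := (hu.comp (tendsto_id.const_mul_atTop (zero_lt_two' ℝ))).sub hu
    simpa using this
  have h2 : Tendsto (fun r => ξ r / r * (u (2 * r) - u r)) atTop (𝓝 0) := by
    refine squeeze_zero_norm' ?_ (by simpa using (h1.norm.const_mul 2))
    filter_upwards [eventually_ge_atTop (max R 1)] with r hr
    have h0 : 0 < r := zero_lt_one.trans_le ((le_max_right R 1).trans hr)
    rw [norm_mul]
    refine mul_le_mul_of_nonneg_right ?_ (norm_nonneg _)
    rw [Real.norm_of_nonneg (div_nonneg (h0.le.trans (hξ r hr).1) h0.le), div_le_iff₀ h0]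
    exact (hξ r hr).2.1
  refine tendsto_nhds_unique ((h.comp hξt).congr' ?_) h2
  filter_upwards [eventually_ge_atTop (max R 1)] with r hr
  have h0 : 0 < r := zero_lt_one.trans_le ((le_max_right R 1).trans hr)
  rw [(hξ r hr).2.2, Function.comp_apply]
  field_simp

theorem FallsLittleO.tendsto {T : Set BCoord} {f : Coord → ℝ} {n : ℤ} (h : FallsLittleO T f n)
    {y : BCoord} (hy : y ∈ T) :
    Tendsto (fun r => f (point r y) * r ^ (-n)) atTop (𝓝 0) := by
  rw [fallsLittleO_iff] at h
  have h1 := (h.comp_tendsto (tendsto_point hy)).mul_isBigO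
    (isBigO_refl (fun r : ℝ => r ^ (-n)) atTop)
  refine (isLittleO_one_iff ℝ).1 (h1.congr' EventuallyEq.rfl ?_)
  filter_upwards [eventually_gt_atTop (0 : ℝ)] with r hr
  rw [Function.comp_apply, zpow_neg]
  exact mul_inv_cancel₀ (zpow_pos hr n).ne'

theorem hasDerivAt_point (r : ℝ) (y : BCoord) :
    HasDerivAt (fun r => point r y) (Pi.single 0 1) r := by
  refine hasDerivAt_pi.2 fun i => ?_
  refine Fin.cases ?_ (fun A => ?_) i
  · simp only [point, Fin.cons_zero, Pi.single_eq_same]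
    exact hasDerivAt_id' r
  · simpa [point, Fin.succ_ne_zero] using hasDerivAt_const r (y A)

theorem hasDerivAt_comp_point {f : Coord → ℝ} {r : ℝ} {y : BCoord}
    (hf : DifferentiableAt ℝ f (point r y)) :
    HasDerivAt (fun r => f (point r y)) (pd 0 f (point r y)) r :=
  hf.hasFDerivAt.comp_hasDerivAt r (hasDerivAt_point r y)

theorem rho_flatMetric (l : ℝ) (Crr : BCoord → ℝ) (CAB : BTensor) (y : BCoord) :
    rho l flatMetric Crr CAB y = CAB y 1 1 - CAB y 0 0 + 1 / l ^ 2 * Crr y := by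
  have h : (flatMetric y)⁻¹ = !![-1, 0; 0, 1] := by
    refine Matrix.inv_eq_left_inv ?_
    ext i j
    fin_cases i <;> fin_cases j <;> simp [flatMetric, Matrix.mul_apply]
  simp [rho, h, Fin.sum_univ_two]
  ring

/-! ### Vanishing of `ρ` -/

namespace BHSolution

variable {l : ℝ} {U : Set Coord} {T : Set BCoord} {g : Metric3}

/-- The expansion of `g_{AB}` is never differentiated: the existence of the limit of `r u'` comes
from the radial equation, and its value from the convergence of `u`. -/
theorem rho_eq_zero (h : BHSolution l U T g) {Crr : BCoord → ℝ} {CAB : BTensor}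
    (hC : HasLeadingTerms l flatMetric T g Crr CAB) {y : BCoord} (hy : y ∈ T) :
    rho l flatMetric Crr CAB y = 0 := by
  have hl := h.pos
  have hb : ∀ r, bdry (point r y) = y := fun r => rfl
  have h0 : ∀ r, point r y 0 = r := fun r => rfl
  have t1 := (hC.tangential 0 0).tendsto hy
  have t2 := (hC.tangential 1 1).tendsto hy
  have t3 := hC.radial.tendsto hy
  have t4 := (h.radial_pd_trace_eq.littleO (n := 0)).tendsto hy
  simp [hb, h0, flatMetric] at t1 t2 t3 t4
  have hu : Tendsto (fun r => g (point r y) 2 2 - g (point r y) 1 1 - 2 * r ^ 2) atTop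
      (𝓝 (CAB y 1 1 - CAB y 0 0)) := by
    have := (t2.sub t1).add_const (CAB y 1 1 - CAB y 0 0)
    exact (this.congr fun r => by ring).mono_right (congrArg 𝓝 (by ring)).le
  have hd : ∀ᶠ r in atTop, HasDerivAt
      (fun r => g (point r y) 2 2 - g (point r y) 1 1 - 2 * r ^ 2)
      (pd 0 (fun z => g z 2 2) (point r y) - pd 0 (fun z => g z 1 1) (point r y) - 4 * r) r := by
    filter_upwards [(tendsto_point hy).eventually h.mem] with r hr
    have d := h.metric.differentiableAt h.isOpen hr
    have e := ((hasDerivAt_id r).pow 2).const_mul 2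
    refine (((hasDerivAt_comp_point (d 2 2)).sub
      (hasDerivAt_comp_point (d 1 1))).sub e).congr_deriv ?_
    simp
    ring
  have hlim : Tendsto (fun r => r * (pd 0 (fun z => g z 2 2) (point r y)
      - pd 0 (fun z => g z 1 1) (point r y) - 4 * r)) atTop
      (𝓝 (2 * rho l flatMetric Crr CAB y)) := by
    -- Solves the radial equation for `r u'`: `t3` replaces the `g_{rr}` correction by `C_{rr}` and
    -- `hu` supplies the limit of `u`.
    have := (((t4.add (t3.const_mul (1 / l ^ 2))).add hu).add_const
      (1 / l ^ 2 * Crr y)).const_mul 2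
    refine (this.congr' ?_).mono_right (congrArg 𝓝 (by rw [rho_flatMetric]; ring)).le
    filter_upwards [eventually_gt_atTop (0 : ℝ)] with r hr
    field_simp
    ring
  have := eq_zero_of_tendsto_mul_deriv hu hd hlim
  linarith

end BHSolution

end AdS3

theorem mainTheorem1 (l : ℝ) (hl : 0 < l)
    (U : Set AdS3.Coord) (hU : IsOpen U)
    (T : Set AdS3.BCoord) (r₀ : ℝ) (hUT : ∀ r > r₀, ∀ y ∈ T, AdS3.point r y ∈ U)
    (g : AdS3.Metric3) (hg : AdS3.IsMetricOn g U)
    (hE : AdS3.SolvesEinstein (-1 / l ^ 2) g U)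
    (hBH : AdS3.BrownHenneaux l AdS3.flatMetric T g) :
    AdS3.FallsLittleO T (fun x => AdS3.meanCurvature g x - AdS3.K₀ l) (-2) ∧
    ∀ (Crr : AdS3.BCoord → ℝ) (CAB : AdS3.BTensor),
      AdS3.HasLeadingTerms l AdS3.flatMetric T g Crr CAB →
        AdS3.GeneralizedBC l AdS3.flatMetric (fun _ => 0) T g Crr CAB ∧
        ∀ y ∈ T, AdS3.rho l AdS3.flatMetric Crr CAB y = 0 := by
  have h : AdS3.BHSolution l U T g := ⟨hl, hU, AdS3.eventually_infinity hUT, hg, hE, hBH⟩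
  have hK := h.fallsBigO_meanCurvature.littleO (n := -2)
  have hc : AdS3.conformalMetric AdS3.flatMetric (fun _ => 0) = AdS3.flatMetric := by
    funext y
    simp [AdS3.conformalMetric]
  refine ⟨hK, fun Crr CAB hC => ⟨⟨hc.symm ▸ hC, fun A => (hBH.mixed A).zero, hK⟩, fun y hy => ?_⟩⟩
  exact h.rho_eq_zero hC hy
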